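/- For positive integers $m,n$, let $Y_{m,n}=\{(i,j): 1\le i\le m,\ 1\le j\le n\}$ be the rectangular Young diagram with $m$ rows and $n$ columns, and number each box by $\alpha_{m,n}(i,j)=\min\{j-i+m,\ i-j+n\}$. For a box $(i,j)$ of a Young diagram $Y$, the hook $h_Y(i,j)$ consists of $(i,j)$, the boxes of $Y$ below it in its column and the boxes of $Y$ to the right of it in its row; removing it means deleting these boxes and then moving each box $(i',j')$ with $i'>i$, $j'>j$ to $(i'-1,j'-1)$. For a hook $h$, let $\mathcal{A}(h)$ denote the multiset of the numbers $\alpha_{m,n}(b)$, $b\in h$. The Multiple Hook Removing Game $\mathrm{MHRG}(m,n)$ is the impartial game (the player making the last move wins) with starting position $Y_{m,n}$ in which a move from a Young diagram $Y\subseteq Y_{m,n}$ is made as follows: the player chooses a box of $Y$ and removes its hook $h$; then, as long as the current diagram has a box whose hook $h'$ satisfies $\mathcal{A}(h')=\mathcal{A}(h)$, the player must choose such a box and remove its hook; the turn ends when there is no such box. The $\mathcal{G}$-value of a position $G$ is defined recursively by $\mathcal{G}(G)=\mathrm{mex}\{\mathcal{G}(G') : G\to G'\}$, where $G\to G'$ means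 that $G'$ can be reached from $G$ by one move and $\mathrm{mex}\,T=\min(\mathbb{Z}_{\ge 0}\setminus T)$. Then for every integer $n\ge 1$, the $\mathcal{G}$-value of the starting position $Y_{n,n}$ of $\mathrm{MHRG}(n,n)$ and the $\mathcal{G}$-value of the starting position $Y_{n,n+1}$ of $\mathrm{MHRG}(n,n+1)$ are both equal to the nim-sum $1\oplus 2\oplus\cdots\oplus n$, i.e. \[ \mathcal{G}(Y_{n,n})=\mathcal{G}(Y_{n,n+1})=\bigoplus_{1\le k\le n} k, \] where $\oplus$ denotes addition of binary expansions without carry. -/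

import Mathlib

/-- A short impartial game with a starting position. Both players have the same moves; the player
who makes the last move wins. `Pos` is the set of game positions, and `Move p q` says that `q` is
an option of `p`. From each position only finitely many positions can be reached, and no position
can occur twice in a play. -/
structure ImpartialGame where
  Pos : Type
  Move : Pos → Pos → Prop
  start : Pos
  finite_reachable : ∀ p, {q | Relation.ReflTransGen Move p q}.Finite
  acyclic : ∀ p, ¬ Relation.TransGen Move p p

/-- The minimal excluded value `min (ℕ \ T)` of a proper subset `T` of `ℕ`. -/
noncomputable def mex (T : Set ℕ) : ℕ := sInf Tᶜ

namespace ImpartialGame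

theorem ncard_reachable_lt (G : ImpartialGame) {p q : G.Pos} (h : G.Move p q) :
    {r | Relation.ReflTransGen G.Move q r}.ncard <
      {r | Relation.ReflTransGen G.Move p r}.ncard := by
  refine Set.ncard_lt_ncard ⟨fun r hr => Relation.ReflTransGen.head h hr, fun hs => ?_⟩
    (G.finite_reachable p)
  have hqp : Relation.ReflTransGen G.Move q p :=
    hs (show p ∈ {r | Relation.ReflTransGen G.Move p r} from Relation.ReflTransGen.refl)
  exact G.acyclic p (Relation.TransGen.head' h hqp)

/-- The `𝒢`-value (Sprague–Grundy value) of a position: the mex of the `𝒢`-values of its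
options. -/
noncomputable def grundy (G : ImpartialGame) (p : G.Pos) : ℕ :=
  mex (Set.range fun q : {q : G.Pos // G.Move p q} => G.grundy q.1)
termination_by {r | Relation.ReflTransGen G.Move p r}.ncard
decreasing_by exact G.ncard_reachable_lt q.2

end ImpartialGame

namespace YoungDiagram

/-- The hook of the box `c` in `Y`: the box `c`, the boxes of `Y` below it in its column, and the
boxes of `Y` to the right of it in its row. Boxes are indexed from `(0, 0)`. -/
def hook (Y : YoungDiagram) (c : ℕ × ℕ) : Finset (ℕ × ℕ) :=
  Y.cells.filter fun b => b = c ∨ (c.1 < b.1 ∧ b.2 = c.2) ∨ (b.1 = c.1 ∧ c.2 < b.2)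

/-- The displacement of the boxes remaining after the removal of the hook of `c`: a box strictly
below and strictly to the right of `c` moves one step diagonally up-left, the others stay. -/
def hookShift (c b : ℕ × ℕ) : ℕ × ℕ :=
  if c.1 < b.1 ∧ c.2 < b.2 then (b.1 - 1, b.2 - 1) else b

/-- The Young diagram `Y \ h_Y(c)` obtained from `Y` by removing the hook of the box `c`. -/
def removeHook (Y : YoungDiagram) (c : ℕ × ℕ) : YoungDiagram where
  cells := (Y.cells \ Y.hook c).image (hookShift c)
  isLowerSet := by
    have key : ∀ a : ℕ × ℕ, a ∈ (Y.cells \ Y.hook c).image (hookShift c) ↔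
        (a ∈ Y ∧ (a.1 < c.1 ∨ a.2 < c.2)) ∨
          (c.1 ≤ a.1 ∧ c.2 ≤ a.2 ∧ (a.1 + 1, a.2 + 1) ∈ Y) := by
      rintro ⟨a1, a2⟩
      obtain ⟨c1, c2⟩ := c
      simp only [Finset.mem_image, Finset.mem_sdiff, hook, Finset.mem_filter, hookShift,
        YoungDiagram.mem_cells, Prod.exists, Prod.mk.injEq]
      constructor
      · rintro ⟨b1, b2, ⟨hb, hn⟩, he⟩
        split_ifs at he with h
        · simp only [Prod.mk.injEq] at he
          right
          have e1 : a1 + 1 = b1 := by omega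
          have e2 : a2 + 1 = b2 := by omega
          refine ⟨by omega, by omega, ?_⟩
          rw [e1, e2]; exact hb
        · simp only [Prod.mk.injEq] at he
          obtain ⟨rfl, rfl⟩ := he
          left
          refine ⟨hb, ?_⟩
          by_contra hc
          apply hn
          refine ⟨hb, ?_⟩
          omega
      · rintro (⟨ha, h⟩ | ⟨h1, h2, ha⟩)
        · refine ⟨a1, a2, ⟨ha, ?_⟩, ?_⟩
          · rintro ⟨-, h'⟩
            omega
          · rw [if_neg (by omega)]
        · refine ⟨a1 + 1, a2 + 1, ⟨ha, ?_⟩, ?_⟩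
          · rintro ⟨-, h'⟩
            omega
          · rw [if_pos (by omega)]; rfl
    intro a b hba ha
    rw [Finset.mem_coe, key] at ha ⊢
    obtain ⟨h1, h2⟩ := Prod.mk_le_mk.1 (show (b.1, b.2) ≤ (a.1, a.2) from hba)
    rcases ha with ⟨ha, h⟩ | ⟨ha1, ha2, ha⟩
    · exact Or.inl ⟨Y.up_left_mem h1 h2 ha, by omega⟩
    · by_cases hb : b.1 < c.1 ∨ b.2 < c.2
      · exact Or.inl ⟨Y.up_left_mem (by omega) (by omega) ha, hb⟩
      · exact Or.inr ⟨by omega, by omega, Y.up_left_mem (by omega) (by omega) ha⟩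

theorem hookShift_le (c b : ℕ × ℕ) : hookShift c b ≤ b := by
  unfold hookShift
  split_ifs
  · exact ⟨Nat.sub_le _ _, Nat.sub_le _ _⟩
  · exact le_rfl

theorem removeHook_lt (Y : YoungDiagram) {c : ℕ × ℕ} (hc : c ∈ Y) : Y.removeHook c < Y := by
  rw [← cells_ssubset_iff]
  refine (Finset.ssubset_iff_subset_ne).2 ⟨?_, fun he => ?_⟩
  · intro a ha
    obtain ⟨b, hb, rfl⟩ := Finset.mem_image.1 ha
    exact Y.isLowerSet (hookShift_le c b) (Finset.mem_sdiff.1 hb).1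
  · have h1 : (Y.removeHook c).cells.card ≤ (Y.cells \ Y.hook c).card := Finset.card_image_le
    have h2 : (Y.cells \ Y.hook c).card < Y.cells.card := by
      refine Finset.card_lt_card (Finset.ssubset_iff_subset_ne.2 ⟨Finset.sdiff_subset, ?_⟩)
      intro h
      have hc' : c ∈ Y.cells \ Y.hook c := by rw [h]; exact hc
      exact (Finset.mem_sdiff.1 hc').2 (Finset.mem_filter.2 ⟨hc, Or.inl rfl⟩)
    rw [he] at h1
    omega

/-- The multiset `𝒜(h_Y(c))` of the numbers in the boxes of the hook of `c`. -/
def hookNumbers (α : ℕ × ℕ → ℕ) (Y : YoungDiagram) (c : ℕ × ℕ) : Multiset ℕ :=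
  (Y.hook c).val.map α

/-- `Y.Forced α A Z`: starting from `Y`, one may end the turn at `Z` by removing, as long as there
is one, some hook whose multiset of numbers is `A`. -/
inductive Forced (α : ℕ × ℕ → ℕ) (A : Multiset ℕ) : YoungDiagram → YoungDiagram → Prop
  | done (Y : YoungDiagram) (h : ∀ c ∈ Y, hookNumbers α Y c ≠ A) : Forced α A Y Y
  | step (Y Z : YoungDiagram) (c : ℕ × ℕ) (hc : c ∈ Y) (hA : hookNumbers α Y c = A)
      (h : Forced α A (Y.removeHook c) Z) : Forced α A Y Z

/-- A move of the Multiple Hook Removing Game with numbering `α`: the player removes the hook of a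
box `c` of `Y`, and must then go on removing hooks with the same multiset of numbers as the first
one until there is none left. -/
def MHRGMove (α : ℕ × ℕ → ℕ) (Y Z : YoungDiagram) : Prop :=
  ∃ c ∈ Y, Forced α (hookNumbers α Y c) (Y.removeHook c) Z

theorem Forced.le {α : ℕ × ℕ → ℕ} {A : Multiset ℕ} {Y Z : YoungDiagram} (h : Forced α A Y Z) :
    Z ≤ Y := by
  induction h with
  | done Y _ => exact le_rfl
  | step Y Z c hc _ _ ih => exact ih.trans (Y.removeHook_lt hc).le

theorem MHRGMove.lt {α : ℕ × ℕ → ℕ} {Y Z : YoungDiagram} (h : MHRGMove α Y Z) : Z < Y := by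
  obtain ⟨c, hc, hf⟩ := h
  exact hf.le.trans_lt (Y.removeHook_lt hc)

theorem finite_Iic (Y : YoungDiagram) : (Set.Iic Y).Finite := by
  refine Set.Finite.of_finite_image (f := YoungDiagram.cells) ?_
    (fun a _ b _ h => YoungDiagram.ext h)
  refine (Finset.finite_toSet Y.cells.powerset).subset ?_
  rintro _ ⟨Z, hZ, rfl⟩
  exact Finset.mem_coe.2 (Finset.mem_powerset.2 (cells_subset_iff.2 hZ))

/-- The rectangular Young diagram with `m` rows and `n` columns. -/
def rect (m n : ℕ) : YoungDiagram where
  cells := Finset.range m ×ˢ Finset.range n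
  isLowerSet := by
    rintro ⟨a1, a2⟩ ⟨b1, b2⟩ ⟨h1, h2⟩ ha
    simp only [Finset.coe_product, Finset.coe_range, Set.mem_prod, Set.mem_Iio] at ha ⊢
    exact ⟨lt_of_le_of_lt h1 ha.1, lt_of_le_of_lt h2 ha.2⟩

end YoungDiagram

/-- The Multiple Hook Removing Game with starting position `Y` and numbering `α` (of which only the
values on `Y` matter). Its positions are the Young diagrams that can be reached from `Y`. -/
def MHRG (Y : YoungDiagram) (α : ℕ × ℕ → ℕ) : ImpartialGame where
  Pos := {Z : YoungDiagram // Relation.ReflTransGen (YoungDiagram.MHRGMove α) Y Z}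
  Move p q := YoungDiagram.MHRGMove α p.1 q.1
  start := ⟨Y, Relation.ReflTransGen.refl⟩
  finite_reachable := by
    intro p
    refine Set.Finite.of_finite_image (f := Subtype.val) ?_ Subtype.val_injective.injOn
    refine (YoungDiagram.finite_Iic p.1).subset ?_
    rintro _ ⟨q, hq, rfl⟩
    change Relation.ReflTransGen _ p q at hq
    induction hq with
    | refl => exact le_refl p.1
    | tail _ h ih => exact h.lt.le.trans ih
  acyclic := by
    intro p hp
    have key : ∀ q, Relation.TransGen (fun p q : {Z : YoungDiagram //
        Relation.ReflTransGen (YoungDiagram.MHRGMove α) Y Z} =>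
        YoungDiagram.MHRGMove α p.1 q.1) p q → q.1 < p.1 := by
      intro q hq
      induction hq with
      | single h => exact h.lt
      | tail _ h ih => exact h.lt.trans ih
    exact lt_irrefl _ (key p hp)

/-- The unimodal numbering `min (j - i + m) (i - j + n)` of the boxes `(i, j)` of the `m × n`
rectangle. The value depends on `j - i` only, so it is unaffected by indexing boxes from `(0, 0)`;
for `i < m` and `j < n` the subtractions do not truncate and the value is positive. -/
def unimodalNumbering (m n : ℕ) (c : ℕ × ℕ) : ℕ :=
  min (c.2 + m - c.1) (c.1 + n - c.2)

/-- `MHRG(m,n)`: the game whose starting position is the `m × n` rectangle with the unimodal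
numbering. -/
def rectMHRG (m n : ℕ) : ImpartialGame :=
  MHRG (YoungDiagram.rect m n) (unimodalNumbering m n)

/-- The nim-sum `1 ⊕ 2 ⊕ ⋯ ⊕ n` (binary addition without carry). -/
def nimSumUpTo (n : ℕ) : ℕ :=
  (Finset.Icc 1 n).fold (fun a b => a ^^^ b) 0 fun k => k

/-!
A Young diagram is determined by its boundary path, hence by the set of positions of the vertical
steps of that path. The hooks of the diagram correspond to the pairs of a horizontal step `q` and a
later vertical step `p`; removing the hook exchanges the two steps, and the boxes of the hook have
the contents `q, …, p - 1`, once each. As the numbering is a unimodal function of the content,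
symmetric under `k ↦ n - m - k`, the numbers in a hook determine `q` and `p` up to the reflection
`k ↦ n - m + 1 - k` of the steps.

When `n - m` is `0` or `1`, this reflection interchanges the vertical and the horizontal steps of
the rectangle (a step fixed by it being horizontal), and a turn, which makes an exchange and then
its mirror image if that is a different one, preserves this property. Such a diagram is a row of
`m` coins, where coin `x` is the `x`-th pair of mirror-image steps, counted from the middle, and
shows heads when the right one of the two is vertical. A turn turns a coin `x` from heads to tails
and possibly also one coin `y < x`, so the value is the nim-sum of the coins showing heads. In the
rectangle these are all the coins.
-/

theorem ImpartialGame.grundy_eq_of_forall_move (G : ImpartialGame) (I : Set G.Pos) (g : G.Pos → ℕ)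
    (hI : ∀ p ∈ I, ∀ q, G.Move p q → q ∈ I) (hne : ∀ p ∈ I, ∀ q, G.Move p q → g q ≠ g p)
    (hlt : ∀ p ∈ I, ∀ v < g p, ∃ q, G.Move p q ∧ g q = v) {p : G.Pos} (hp : p ∈ I) :
    G.grundy p = g p := by
  induction p using ImpartialGame.grundy.induct G with
  | case1 p ih =>
    have options : Set.range (fun q : {q // G.Move p q} => G.grundy q.1) =
        g '' {q | G.Move p q} := by
      rw [Set.image_eq_range]
      exact congrArg Set.range (funext fun q => ih q (hI p hp q.1 q.2))
    rw [ImpartialGame.grundy, options]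
    refine IsLeast.csInf_eq ⟨?_, fun v hv => not_lt.1 fun h => hv ?_⟩
    · rintro ⟨q, hq, h⟩
      exact hne p hp q hq h
    · exact hlt p hp v h

/-- The nim-sum of the elements of a finite set. -/
def nimSum (s : Finset ℕ) : ℕ := s.fold (fun a b => a ^^^ b) 0 id

theorem nimSum_insert {s : Finset ℕ} {a : ℕ} (ha : a ∉ s) : nimSum (insert a s) = a ^^^ nimSum s :=
  Finset.fold_insert ha

theorem nimSum_pair {x y : ℕ} (h : x ≠ y) : nimSum {x, y} = x ^^^ y := by
  rw [nimSum_insert (by simpa using h), ← insert_empty_eq, nimSum_insert (Finset.notMem_empty y)]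
  exact congrArg (x ^^^ ·) (Nat.xor_zero y)

theorem nimSum_erase_zero (s : Finset ℕ) : nimSum (s.erase 0) = nimSum s := by
  by_cases h : 0 ∈ s
  · conv_rhs => rw [← Finset.insert_erase h, nimSum_insert (Finset.notMem_erase 0 s), Nat.zero_xor]
  · rw [Finset.erase_eq_of_notMem h]

theorem nimSum_symmDiff (s t : Finset ℕ) : nimSum (symmDiff s t) = nimSum s ^^^ nimSum t := by
  have h₁ : nimSum (s ∪ t) ^^^ nimSum (s ∩ t) = nimSum s ^^^ nimSum t :=
    Finset.fold_union_inter (op := fun a b : ℕ => a ^^^ b)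
  have h₂ : nimSum (s ∪ t) = nimSum (symmDiff s t) ^^^ nimSum (s ∩ t) := by
    have h := Finset.fold_union_inter (op := fun a b : ℕ => a ^^^ b) (f := id) (b₁ := 0) (b₂ := 0)
      (s₁ := symmDiff s t) (s₂ := s ∩ t)
    rw [← Finset.sup_eq_union, ← Finset.inf_eq_inter, ← Finset.inf_eq_inter, symmDiff_sup_inf,
      (disjoint_symmDiff_inf s t).eq_bot] at h
    exact (Nat.xor_zero _).symm.trans h
  rw [← h₁, h₂, Nat.xor_xor_cancel_right]

theorem exists_xor_lt_of_lt_nimSum {s : Finset ℕ} {v : ℕ} (hv : v < nimSum s) :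
    ∃ x ∈ s, x ^^^ (nimSum s ^^^ v) < x := by
  induction s using Finset.induction_on generalizing v with
  | empty => exact absurd hv (Nat.not_lt_zero v)
  | insert a t ha ih =>
    rw [nimSum_insert ha] at hv ⊢
    rcases Nat.lt_xor_cases hv with h | h
    · refine ⟨a, Finset.mem_insert_self a t, ?_⟩
      rwa [Nat.xor_assoc, Nat.xor_xor_cancel_left, Nat.xor_comm]
    · obtain ⟨x, hx, hlt⟩ := ih h
      refine ⟨x, Finset.mem_insert_of_mem hx, ?_⟩
      rwa [Nat.xor_comm a, Nat.xor_assoc, Nat.xor_comm a]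

theorem exists_nimSum_xor_eq_of_lt {s : Finset ℕ} {v : ℕ} (hv : v < nimSum s) :
    ∃ x ∈ s, ∃ y < x, nimSum s ^^^ (x ^^^ y) = v := by
  obtain ⟨x, hx, hlt⟩ := exists_xor_lt_of_lt_nimSum hv
  exact ⟨x, hx, _, hlt, by rw [Nat.xor_xor_cancel_left, Nat.xor_xor_cancel_left]⟩

namespace MHRG

open YoungDiagram

section Boundary

variable (Y : YoungDiagram)

/-- The positions of the vertical steps on the boundary path of `Y`, which comes up the left border
from infinitely far below and leaves to the right along the top border. Step `k` lies between the
diagonals of content `k - 1` and `k`, so the step at the end of row `i` has position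
`rowLen i - i`; the rows of length `0` are included. -/
def verticalSteps : Set ℤ := Set.range fun i : ℕ => (Y.rowLen i : ℤ) - i

/-- The position of the horizontal step at the bottom of the column of `c`, where the hook of `c`
begins. -/
def footStep (c : ℕ × ℕ) : ℤ := c.2 - Y.colLen c.2 + 1

/-- The position of the vertical step at the right end of the row of `c`, where the hook of `c`
ends. -/
def handStep (c : ℕ × ℕ) : ℤ := Y.rowLen c.1 - c.1

/-- A horizontal step `q` of a boundary path with vertical steps `V` that precedes a vertical
step `p`; such pairs correspond to the hooks of the diagram. -/
structure IsInversion (V : Set ℤ) (q p : ℤ) : Prop where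
  notMem : q ∉ V
  mem : p ∈ V
  lt : q < p

/-- The vertical steps after the horizontal step `q` and the vertical step `p` trade places. -/
def exchange (V : Set ℤ) (q p : ℤ) : Set ℤ := insert q (V \ {p})

theorem lt_rowLen_iff_lt_colLen (i j : ℕ) : j < Y.rowLen i ↔ i < Y.colLen j := by
  rw [← mem_iff_lt_rowLen, mem_iff_lt_colLen]

theorem rowLen_sub_strictAnti : StrictAnti fun i : ℕ => (Y.rowLen i : ℤ) - i := by
  intro a b h
  have := Y.rowLen_anti a b h.le
  dsimp only
  omega

theorem notMem_verticalSteps_iff {k : ℤ} :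
    k ∉ verticalSteps Y ↔ ∃ j : ℕ, (j : ℤ) - Y.colLen j + 1 = k := by
  constructor
  · intro hk
    have hex : ∃ i : ℕ, (Y.rowLen i : ℤ) - i < k := by
      refine ⟨Y.rowLen 0 + k.natAbs + 1, ?_⟩
      have := Y.rowLen_anti 0 (Y.rowLen 0 + k.natAbs + 1) (Nat.zero_le _)
      omega
    -- The first row ending before `k` is just below the column that ends at `k`.
    obtain ⟨i, hi, hmin⟩ : ∃ i : ℕ, (Y.rowLen i : ℤ) - i < k ∧
        ∀ a < i, k < (Y.rowLen a : ℤ) - a := by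
      classical
      exact ⟨Nat.find hex, Nat.find_spec hex, fun a ha =>
        lt_of_le_of_ne (not_lt.1 (Nat.find_min hex ha)) fun h => hk ⟨a, h.symm⟩⟩
    refine ⟨(k + i - 1).toNat, ?_⟩
    have hcol := lt_rowLen_iff_lt_colLen Y i (k + i - 1).toNat
    have hcol' := lt_rowLen_iff_lt_colLen Y (i - 1) (k + i - 1).toNat
    have hprev := hmin (i - 1)
    omega
  · rintro ⟨j, rfl⟩ ⟨i, hi⟩
    have := lt_rowLen_iff_lt_colLen Y i j
    dsimp only at hi
    omega

theorem footStep_lt_handStep_iff (c : ℕ × ℕ) : footStep Y c < handStep Y c ↔ c ∈ Y := by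
  obtain ⟨i, j⟩ := c
  have := lt_rowLen_iff_lt_colLen Y i j
  simp only [mem_iff_lt_rowLen, footStep, handStep]
  omega

theorem isInversion_footStep_handStep {c : ℕ × ℕ} (hc : c ∈ Y) :
    IsInversion (verticalSteps Y) (footStep Y c) (handStep Y c) :=
  ⟨(notMem_verticalSteps_iff Y).2 ⟨c.2, rfl⟩, ⟨c.1, rfl⟩, (footStep_lt_handStep_iff Y c).2 hc⟩

theorem exists_mem_of_isInversion {q p : ℤ} (h : IsInversion (verticalSteps Y) q p) :
    ∃ c ∈ Y, footStep Y c = q ∧ handStep Y c = p := by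
  obtain ⟨j, rfl⟩ := (notMem_verticalSteps_iff Y).1 h.notMem
  obtain ⟨i, rfl⟩ := h.mem
  exact ⟨(i, j), (footStep_lt_handStep_iff Y (i, j)).1 h.lt, rfl, rfl⟩

theorem mem_removeHook (i j a b : ℕ) :
    (a, b) ∈ Y.removeHook (i, j) ↔
      ((a, b) ∈ Y ∧ (a < i ∨ b < j)) ∨ (i ≤ a ∧ j ≤ b ∧ (a + 1, b + 1) ∈ Y) := by
  rw [← mem_cells]
  simp only [removeHook, Finset.mem_image, Finset.mem_sdiff, hook, Finset.mem_filter, hookShift,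
    mem_cells, Prod.exists, Prod.mk.injEq]
  constructor
  · rintro ⟨a', b', ⟨hmem, hout⟩, heq⟩
    split_ifs at heq with hshift <;> simp only [Prod.mk.injEq] at heq
    · obtain rfl : a + 1 = a' := by omega
      obtain rfl : b + 1 = b' := by omega
      exact Or.inr ⟨by omega, by omega, hmem⟩
    · obtain ⟨rfl, rfl⟩ := heq
      exact Or.inl ⟨hmem, by by_contra h; exact hout ⟨hmem, by omega⟩⟩
  · rintro (⟨hmem, hfix⟩ | ⟨hi, hj, hmem⟩)
    · exact ⟨a, b, ⟨hmem, fun h => by omega⟩, by rw [if_neg (by omega)]⟩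
    · exact ⟨a + 1, b + 1, ⟨hmem, fun h => by omega⟩, by rw [if_pos (by omega)]; rfl⟩

theorem rowLen_removeHook (i j a : ℕ) :
    (Y.removeHook (i, j)).rowLen a =
      if i ≤ a ∧ a < Y.colLen j then max j (Y.rowLen (a + 1) - 1) else Y.rowLen a := by
  refine eq_of_forall_lt_iff fun b => ?_
  have hcol := lt_rowLen_iff_lt_colLen Y a j
  have hanti := Y.rowLen_anti a (a + 1) (Nat.le_succ a)
  rw [← mem_iff_lt_rowLen, mem_removeHook, mem_iff_lt_rowLen, mem_iff_lt_rowLen]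
  split_ifs <;> omega

theorem verticalSteps_removeHook {c : ℕ × ℕ} (hc : c ∈ Y) :
    verticalSteps (Y.removeHook c) = exchange (verticalSteps Y) (footStep Y c) (handStep Y c) := by
  obtain ⟨i, j⟩ := c
  have hi : i < Y.colLen j := mem_iff_lt_colLen.1 hc
  have hne {a : ℕ} (h : a ≠ i) : (Y.rowLen a : ℤ) - a ≠ Y.rowLen i - i :=
    (rowLen_sub_strictAnti Y).injective.ne h
  ext k
  simp only [verticalSteps, exchange, footStep, handStep, Set.mem_insert_iff, Set.mem_sdiff,
    Set.mem_singleton_iff, Set.mem_range, rowLen_removeHook]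
  constructor
  · rintro ⟨a, rfl⟩
    have hcol := lt_rowLen_iff_lt_colLen Y (a + 1) j
    split_ifs with ha
    · rcases (Nat.succ_le_of_lt ha.2).eq_or_lt with hlast | hlast
      · exact Or.inl (by omega)
      · exact Or.inr ⟨⟨a + 1, by omega⟩, by have := hne (a := a + 1) (by omega); omega⟩
    · exact Or.inr ⟨⟨a, rfl⟩, hne (by omega)⟩
  · rintro (rfl | ⟨⟨a, rfl⟩, hai⟩)
    · have hcol := lt_rowLen_iff_lt_colLen Y (Y.colLen j) j
      exact ⟨Y.colLen j - 1, by rw [if_pos (by omega), Nat.sub_add_cancel (by omega)]; omega⟩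
    · by_cases ha : i < a ∧ a < Y.colLen j
      · have hcol := lt_rowLen_iff_lt_colLen Y a j
        exact ⟨a - 1, by rw [if_pos (by omega), Nat.sub_add_cancel (by omega)]; omega⟩
      · have : a ≠ i := fun h => hai (h ▸ rfl)
        exact ⟨a, by rw [if_neg (by omega)]⟩

theorem mem_hook_iff {c : ℕ × ℕ} (hc : c ∈ Y) (a b : ℕ) :
    (a, b) ∈ Y.hook c ↔
      (c.1 ≤ a ∧ a < Y.colLen c.2 ∧ b = c.2) ∨ (a = c.1 ∧ c.2 < b ∧ b < Y.rowLen c.1) := by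
  obtain ⟨i, j⟩ := c
  rw [mem_iff_lt_rowLen] at hc
  have hcol := lt_rowLen_iff_lt_colLen Y a j
  simp only [hook, Finset.mem_filter, mem_cells, Prod.mk.injEq, mem_iff_lt_rowLen]
  constructor
  · rintro ⟨hab, ⟨rfl, rfl⟩ | ⟨h, rfl⟩ | ⟨rfl, h⟩⟩ <;> omega
  · rintro (⟨h1, h2, rfl⟩ | ⟨rfl, h1, h2⟩) <;> omega

theorem injOn_content_hook {c : ℕ × ℕ} (hc : c ∈ Y) :
    Set.InjOn (fun b : ℕ × ℕ => (b.2 : ℤ) - b.1) (Y.hook c) := by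
  rintro ⟨a, b⟩ h ⟨a', b'⟩ h' heq
  rw [Finset.mem_coe, mem_hook_iff Y hc] at h h'
  dsimp only at heq
  rw [Prod.mk.injEq]
  omega

theorem image_content_hook {c : ℕ × ℕ} (hc : c ∈ Y) :
    (Y.hook c).image (fun b : ℕ × ℕ => (b.2 : ℤ) - b.1) =
      Finset.Ico (footStep Y c) (handStep Y c) := by
  have hrow := mem_iff_lt_rowLen.1 hc
  have hcol := mem_iff_lt_colLen.1 hc
  ext k
  simp only [Finset.mem_image, Prod.exists, mem_hook_iff Y hc, Finset.mem_Ico, footStep, handStep]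
  constructor
  · rintro ⟨a, b, h, rfl⟩
    omega
  · rintro ⟨hfoot, hhand⟩
    rcases le_or_gt k ((c.2 : ℤ) - c.1) with h | h
    · exact ⟨(c.2 - k).toNat, c.2, by omega⟩
    · exact ⟨c.1, (k + c.1).toNat, by omega⟩

theorem hookNumbers_eq_map_Ico {α : ℕ × ℕ → ℕ} {f : ℤ → ℕ}
    (hf : ∀ b : ℕ × ℕ, α b = f ((b.2 : ℤ) - b.1)) {c : ℕ × ℕ} (hc : c ∈ Y) :
    hookNumbers α Y c = (Finset.Ico (footStep Y c) (handStep Y c)).val.map f := by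
  rw [← image_content_hook Y hc, Finset.image_val_of_injOn (injOn_content_hook Y hc),
    Multiset.map_map]
  exact Multiset.map_congr rfl fun b _ => hf b

end Boundary

section Numbering

variable {m n : ℕ}

/-- The unimodal numbering as a function of the content `j - i`. -/
def contentNumber (m n : ℕ) (k : ℤ) : ℕ := (min (k + m) (n - k)).toNat

theorem unimodalNumbering_eq_contentNumber (m n : ℕ) (b : ℕ × ℕ) :
    unimodalNumbering m n b = contentNumber m n ((b.2 : ℤ) - b.1) := by
  unfold unimodalNumbering contentNumber
  omega

theorem map_contentNumber_Ico_reflect (m n : ℕ) (q p : ℤ) :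
    (Finset.Ico (n - m + 1 - p) (n - m + 1 - q)).val.map (contentNumber m n) =
      (Finset.Ico q p).val.map (contentNumber m n) := by
  have himage : (Finset.Ico q p).image (fun k => (n : ℤ) - m - k) =
      Finset.Ico (n - m + 1 - p) (n - m + 1 - q) := by
    ext k
    simp only [Finset.mem_Ico, Finset.mem_image]
    exact ⟨by rintro ⟨l, h, rfl⟩; omega, fun h => ⟨n - m - k, by omega⟩⟩
  rw [← himage, Finset.image_val_of_injOn fun a _ b _ h => sub_right_injective h,
    Multiset.map_map]
  refine Multiset.map_congr rfl fun k _ => ?_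
  simp only [Function.comp_apply, contentNumber]
  omega

theorem contentNumber_le_of_mem_Ico {q p k : ℤ} (hmid : q + p ≤ n - m + 1)
    (hk : k ∈ Finset.Ico q p) : contentNumber m n q ≤ contentNumber m n k := by
  rw [Finset.mem_Ico] at hk
  unfold contentNumber
  omega

/-- On an interval centred in the left half, the least number is the one at the left end. -/
theorem eq_of_map_contentNumber_eq_of_add_le {q p q' p' : ℤ} (hq : -(m : ℤ) ≤ q) (hqp : q < p)
    (hmid : q + p ≤ n - m + 1) (hq' : -(m : ℤ) ≤ q') (hqp' : q' < p') (hmid' : q' + p' ≤ n - m + 1)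
    (h : (Finset.Ico q p).val.map (contentNumber m n) =
      (Finset.Ico q' p').val.map (contentNumber m n)) : q = q' ∧ p = p' := by
  have left_le {a b a' b' : ℤ} (hab : a < b) (hmid' : a' + b' ≤ n - m + 1)
      (h : (Finset.Ico a b).val.map (contentNumber m n) =
        (Finset.Ico a' b').val.map (contentNumber m n)) :
      contentNumber m n a' ≤ contentNumber m n a := by
    have ha : contentNumber m n a ∈ (Finset.Ico a' b').val.map (contentNumber m n) :=
      h ▸ Multiset.mem_map_of_mem _ (Finset.left_mem_Ico.2 hab)
    obtain ⟨k, hk, hka⟩ := Multiset.mem_map.1 ha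
    exact hka ▸ contentNumber_le_of_mem_Ico hmid' hk
  have hleft : contentNumber m n q = contentNumber m n q' :=
    (left_le hqp' hmid h.symm).antisymm (left_le hqp hmid' h)
  have hcard := congrArg Multiset.card h
  simp only [Multiset.card_map, Finset.card_val, Int.card_Ico] at hcard
  unfold contentNumber at hleft
  omega

theorem map_contentNumber_eq_iff {q p q' p' : ℤ} (hq : 1 - (m : ℤ) ≤ q) (hqp : q < p)
    (hp : p ≤ n) (hq' : 1 - (m : ℤ) ≤ q') (hqp' : q' < p') (hp' : p' ≤ n) :
    (Finset.Ico q p).val.map (contentNumber m n) =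
        (Finset.Ico q' p').val.map (contentNumber m n) ↔
      (q = q' ∧ p = p') ∨ (q = n - m + 1 - p' ∧ p = n - m + 1 - q') := by
  constructor
  · intro h
    rcases le_total (q + p) (n - m + 1) with hmid | hmid <;>
      rcases le_total (q' + p') (n - m + 1) with hmid' | hmid'
    · have := eq_of_map_contentNumber_eq_of_add_le (by omega) hqp hmid (by omega) hqp' hmid' h
      omega
    · rw [← map_contentNumber_Ico_reflect m n q' p'] at h
      have := eq_of_map_contentNumber_eq_of_add_le (by omega) hqp hmid (by omega) (by omega)
        (by omega) h
      omega
    · rw [← map_contentNumber_Ico_reflect m n q p] at h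
      have := eq_of_map_contentNumber_eq_of_add_le (by omega) (by omega) (by omega) (by omega)
        hqp' hmid' h
      omega
    · rw [← map_contentNumber_Ico_reflect m n q p, ← map_contentNumber_Ico_reflect m n q' p'] at h
      have := eq_of_map_contentNumber_eq_of_add_le (by omega) (by omega) (by omega) (by omega)
        (by omega) (by omega) h
      omega
  · rintro (⟨rfl, rfl⟩ | ⟨rfl, rfl⟩)
    · rfl
    · exact map_contentNumber_Ico_reflect m n q' p'

theorem mem_rect {i j : ℕ} : (i, j) ∈ rect m n ↔ i < m ∧ j < n := by
  rw [← mem_cells]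
  simp only [rect, Finset.mem_product, Finset.mem_range]

theorem le_of_notMem_verticalSteps {Y : YoungDiagram} (hY : Y ≤ rect m n) {k : ℤ}
    (hk : k ∉ verticalSteps Y) : 1 - (m : ℤ) ≤ k := by
  obtain ⟨j, rfl⟩ := (notMem_verticalSteps_iff Y).1 hk
  have hcol : Y.colLen j ≤ m :=
    not_lt.1 fun h => (mem_rect.1 (hY (mem_iff_lt_colLen.2 h))).1.false
  omega

theorem le_of_mem_verticalSteps {Y : YoungDiagram} (hY : Y ≤ rect m n) {k : ℤ}
    (hk : k ∈ verticalSteps Y) : k ≤ n := by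
  obtain ⟨i, rfl⟩ := hk
  have hrow : Y.rowLen i ≤ n :=
    not_lt.1 fun h => (mem_rect.1 (hY (mem_iff_lt_rowLen.2 h))).2.false
  dsimp only
  omega

theorem hookNumbers_eq_iff {X Y : YoungDiagram} (hX : X ≤ rect m n) (hY : Y ≤ rect m n)
    {b c : ℕ × ℕ} (hb : b ∈ X) (hc : c ∈ Y) :
    hookNumbers (unimodalNumbering m n) X b = hookNumbers (unimodalNumbering m n) Y c ↔
      (footStep X b = footStep Y c ∧ handStep X b = handStep Y c) ∨
        (footStep X b = n - m + 1 - handStep Y c ∧ handStep X b = n - m + 1 - footStep Y c) := by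
  have hXinv := isInversion_footStep_handStep X hb
  have hYinv := isInversion_footStep_handStep Y hc
  rw [hookNumbers_eq_map_Ico X (unimodalNumbering_eq_contentNumber m n) hb,
    hookNumbers_eq_map_Ico Y (unimodalNumbering_eq_contentNumber m n) hc]
  exact map_contentNumber_eq_iff (le_of_notMem_verticalSteps hX hXinv.notMem) hXinv.lt
    (le_of_mem_verticalSteps hX hXinv.mem) (le_of_notMem_verticalSteps hY hYinv.notMem) hYinv.lt
    (le_of_mem_verticalSteps hY hYinv.mem)

end Numbering

section Antisymmetric

variable {s : ℤ} {V : Set ℤ} {q p : ℤ}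

/-- The reflection `k ↦ s - k` interchanges vertical and horizontal steps, except that its fixed
point, when there is one, is a horizontal step. -/
def IsAntisymmetric (s : ℤ) (V : Set ℤ) : Prop := ∀ k, s - k ∈ V ↔ k ∉ V ∧ k ≠ s - k

/-- The vertical steps after exchanging `q` and `p` and then their mirror images under
`k ↦ s - k`. -/
def mirrorExchange (s : ℤ) (V : Set ℤ) (q p : ℤ) : Set ℤ :=
  exchange (exchange V q p) (s - p) (s - q)

theorem mem_exchange {k : ℤ} : k ∈ exchange V q p ↔ k = q ∨ (k ∈ V ∧ k ≠ p) := Iff.rfl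

theorem mem_mirrorExchange {k : ℤ} :
    k ∈ mirrorExchange s V q p ↔ k = s - p ∨ ((k = q ∨ (k ∈ V ∧ k ≠ p)) ∧ k ≠ s - q) := Iff.rfl

theorem mirrorExchange_of_add_eq (h : q + p = s) : mirrorExchange s V q p = exchange V q p := by
  ext k
  rw [mem_mirrorExchange, mem_exchange]
  grind

theorem IsAntisymmetric.ne_sub_of_mem (hV : IsAntisymmetric s V) {k : ℤ} (hk : k ∈ V) :
    k ≠ s - k :=
  fun h => ((hV k).1 (h ▸ hk)).1 hk

protected theorem IsAntisymmetric.mirrorExchange (hV : IsAntisymmetric s V)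
    (h : IsInversion V q p) : IsAntisymmetric s (mirrorExchange s V q p) := by
  intro k
  have hk := hV k
  have hp := hV.ne_sub_of_mem h.mem
  have hlt := h.lt
  rw [mem_mirrorExchange, mem_mirrorExchange]
  grind

theorem IsAntisymmetric.isInversion_exchange (hV : IsAntisymmetric s V) (h : IsInversion V q p)
    (hne : q + p ≠ s) : IsInversion (exchange V q p) (s - p) (s - q) := by
  have hp := hV p
  have hq := hV q
  obtain ⟨hqV, hpV, hlt⟩ := h
  refine ⟨?_, ?_, by omega⟩ <;> rw [mem_exchange] <;> grind

theorem IsAntisymmetric.not_isInversion_mirrorExchange (hV : IsAntisymmetric s V)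
    (h : IsInversion V q p) : ¬ IsInversion (mirrorExchange s V q p) q p := by
  have hp := hV.ne_sub_of_mem h.mem
  have hlt := h.lt
  intro h'
  have := h'.mem
  rw [mem_mirrorExchange] at this
  omega

theorem not_isInversion_mirrorExchange_mirror :
    ¬ IsInversion (mirrorExchange s V q p) (s - p) (s - q) :=
  fun h => h.notMem (Or.inl rfl)

end Antisymmetric

section Turn

variable {m n : ℕ} {Y Z : YoungDiagram}

theorem exists_forced (α : ℕ × ℕ → ℕ) (A : Multiset ℕ) (Y : YoungDiagram) :
    ∃ Z, Forced α A Y Z := by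
  induction hN : Y.card using Nat.strong_induction_on generalizing Y with
  | _ N ih =>
    by_cases h : ∃ c ∈ Y, hookNumbers α Y c = A
    · obtain ⟨c, hc, hA⟩ := h
      have hcard : (Y.removeHook c).card < N :=
        hN ▸ Finset.card_lt_card (cells_ssubset_iff.2 (Y.removeHook_lt hc))
      obtain ⟨Z, hZ⟩ := ih _ hcard (Y.removeHook c) rfl
      exact ⟨Z, Forced.step Y Z c hc hA hZ⟩
    · push Not at h
      exact ⟨Y, Forced.done Y h⟩

theorem hookNumbers_ne_of_mirrorExchange (hY : Y ≤ rect m n)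
    (hV : IsAntisymmetric (n - m + 1) (verticalSteps Y)) {c : ℕ × ℕ} (hc : c ∈ Y)
    {X : YoungDiagram} (hX : X ≤ rect m n)
    (hXV : verticalSteps X =
      mirrorExchange (n - m + 1) (verticalSteps Y) (footStep Y c) (handStep Y c))
    {b : ℕ × ℕ} (hb : b ∈ X) :
    hookNumbers (unimodalNumbering m n) X b ≠ hookNumbers (unimodalNumbering m n) Y c := by
  intro h
  have hinv := isInversion_footStep_handStep X hb
  rw [hXV] at hinv
  rcases (hookNumbers_eq_iff hX hY hb hc).1 h with ⟨hfoot, hhand⟩ | ⟨hfoot, hhand⟩ <;>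
    rw [hfoot, hhand] at hinv
  · exact hV.not_isInversion_mirrorExchange (isInversion_footStep_handStep Y hc) hinv
  · exact not_isInversion_mirrorExchange_mirror hinv

theorem verticalSteps_removeHook_of_hookNumbers_eq (hY : Y ≤ rect m n) {c : ℕ × ℕ} (hc : c ∈ Y)
    {b : ℕ × ℕ} (hb : b ∈ Y.removeHook c)
    (hA : hookNumbers (unimodalNumbering m n) (Y.removeHook c) b =
      hookNumbers (unimodalNumbering m n) Y c) :
    verticalSteps ((Y.removeHook c).removeHook b) =
      mirrorExchange (n - m + 1) (verticalSteps Y) (footStep Y c) (handStep Y c) := by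
  have hX : Y.removeHook c ≤ rect m n := (Y.removeHook_lt hc).le.trans hY
  rw [verticalSteps_removeHook _ hb]
  rcases (hookNumbers_eq_iff hX hY hb hc).1 hA with ⟨hfoot, -⟩ | ⟨hfoot, hhand⟩
  · have hinv := isInversion_footStep_handStep _ hb
    rw [verticalSteps_removeHook Y hc, hfoot] at hinv
    exact absurd (Or.inl rfl) hinv.notMem
  · rw [hfoot, hhand, verticalSteps_removeHook Y hc, mirrorExchange]

theorem verticalSteps_of_forced_removeHook (hY : Y ≤ rect m n)
    (hV : IsAntisymmetric (n - m + 1) (verticalSteps Y)) {c : ℕ × ℕ} (hc : c ∈ Y)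
    (h : Forced (unimodalNumbering m n) (hookNumbers (unimodalNumbering m n) Y c)
      (Y.removeHook c) Z) :
    verticalSteps Z =
      mirrorExchange (n - m + 1) (verticalSteps Y) (footStep Y c) (handStep Y c) := by
  have hinv := isInversion_footStep_handStep Y hc
  have hX : Y.removeHook c ≤ rect m n := (Y.removeHook_lt hc).le.trans hY
  have hXV := verticalSteps_removeHook Y hc
  by_cases hself : footStep Y c + handStep Y c = n - m + 1
  · rw [← mirrorExchange_of_add_eq hself] at hXV
    cases h with
    | done _ _ => exact hXV
    | step _ _ b hb hA _ =>
      exact absurd hA (hookNumbers_ne_of_mirrorExchange hY hV hc hX hXV hb)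
  · cases h with
    | done _ hdone =>
      have hmirror := hV.isInversion_exchange hinv hself
      rw [← hXV] at hmirror
      obtain ⟨b, hb, hfoot, hhand⟩ := exists_mem_of_isInversion _ hmirror
      exact absurd ((hookNumbers_eq_iff hX hY hb hc).2 (Or.inr ⟨hfoot, hhand⟩)) (hdone b hb)
    | step _ _ b hb hA h =>
      have hWV := verticalSteps_removeHook_of_hookNumbers_eq hY hc hb hA
      have hW := (((Y.removeHook c).removeHook_lt hb).le.trans hX)
      cases h with
      | done _ _ => exact hWV
      | step _ _ b' hb' hA' _ =>
        exact absurd hA' (hookNumbers_ne_of_mirrorExchange hY hV hc hW hWV hb')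

theorem exists_isInversion_of_move (hY : Y ≤ rect m n)
    (hV : IsAntisymmetric (n - m + 1) (verticalSteps Y))
    (h : MHRGMove (unimodalNumbering m n) Y Z) :
    ∃ q p, IsInversion (verticalSteps Y) q p ∧
      verticalSteps Z = mirrorExchange (n - m + 1) (verticalSteps Y) q p := by
  obtain ⟨c, hc, hZ⟩ := h
  exact ⟨_, _, isInversion_footStep_handStep Y hc, verticalSteps_of_forced_removeHook hY hV hc hZ⟩

theorem exists_move_of_isInversion (hY : Y ≤ rect m n)
    (hV : IsAntisymmetric (n - m + 1) (verticalSteps Y)) {q p : ℤ}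
    (h : IsInversion (verticalSteps Y) q p) :
    ∃ Z, MHRGMove (unimodalNumbering m n) Y Z ∧
      verticalSteps Z = mirrorExchange (n - m + 1) (verticalSteps Y) q p := by
  obtain ⟨c, hc, rfl, rfl⟩ := exists_mem_of_isInversion Y h
  obtain ⟨Z, hZ⟩ := exists_forced (unimodalNumbering m n) (hookNumbers (unimodalNumbering m n) Y c)
    (Y.removeHook c)
  exact ⟨Z, ⟨c, hc, hZ⟩, verticalSteps_of_forced_removeHook hY hV hc hZ⟩

end Turn

section Coins

variable {m : ℕ} {s : ℤ} {V : Set ℤ} {q p : ℤ}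

open Classical in
/-- The `x ∈ {1, …, m}` such that the right one of the `x`-th pair of mirror-image steps, counted
from the middle, is vertical. They are the coins showing heads in the coin-turning game to which the
Multiple Hook Removing Game on antisymmetric diagrams reduces. -/
noncomputable def heads (m : ℕ) (s : ℤ) (V : Set ℤ) : Finset ℕ :=
  {x ∈ Finset.Icc 1 m | (x : ℤ) + s - 1 ∈ V}

/-- The number of the coin to which a step and its mirror image belong. A step at the middle gets
the number `0`, which stands for no coin. -/
def coin (s k : ℤ) : ℕ := (max (1 - k) (k - s + 1)).toNat

/-- The coin that is turned together with the coin of `p` when `q` and `p` are exchanged, or `0`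
when the coin of `p` is turned alone. -/
def secondCoin (s q p : ℤ) : ℕ := if q + p = s then 0 else coin s q

theorem mem_heads {x : ℕ} : x ∈ heads m s V ↔ (1 ≤ x ∧ x ≤ m) ∧ (x : ℤ) + s - 1 ∈ V := by
  simp only [heads, Finset.mem_filter, Finset.mem_Icc]

theorem coin_eq_coin_iff (hs : s ≤ 2) {k l : ℤ} : coin s k = coin s l ↔ k = l ∨ k = s - l := by
  unfold coin
  omega

theorem coin_add_sub_one (hs : 0 ≤ s) {x : ℕ} (hx : 1 ≤ x) : coin s (x + s - 1) = x := by
  unfold coin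
  omega

theorem coin_ne_secondCoin (hs : s ≤ 2) (h : IsInversion V q p) :
    coin s p ≠ secondCoin s q p := by
  have hlt := h.lt
  unfold secondCoin
  split_ifs with hself
  · unfold coin
    omega
  · rw [Ne, coin_eq_coin_iff hs]
    omega

theorem heads_mirrorExchange (hs : 1 ≤ s) (hs' : s ≤ 2) (hV : IsAntisymmetric s V)
    (h : IsInversion V q p) (hq : 1 - (m : ℤ) ≤ q) (hp : p ≤ m + s - 1) :
    (heads m s (mirrorExchange s V q p)).erase 0 =
      (symmDiff (heads m s V) {coin s p, secondCoin s q p}).erase 0 := by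
  ext x
  have hx : 1 ≤ x → coin s (x + s - 1) = x := coin_add_sub_one (by omega)
  have hxp := coin_eq_coin_iff hs' (k := x + s - 1) (l := p)
  have hxq := coin_eq_coin_iff hs' (k := x + s - 1) (l := q)
  have hpm : coin s p ≤ m := by have := h.lt; unfold coin; omega
  have hqm : coin s q ≤ m := by have := h.lt; unfold coin; omega
  have hVp := hV p
  have hVq := hV q
  obtain ⟨hqV, hpV, hlt⟩ := h
  simp only [Finset.mem_erase, Finset.mem_symmDiff, Finset.mem_insert, Finset.mem_singleton,
    mem_heads, mem_mirrorExchange, secondCoin]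
  grind

theorem nimSum_heads_mirrorExchange (hs : 1 ≤ s) (hs' : s ≤ 2) (hV : IsAntisymmetric s V)
    (h : IsInversion V q p) (hq : 1 - (m : ℤ) ≤ q) (hp : p ≤ m + s - 1) :
    nimSum (heads m s (mirrorExchange s V q p)) =
      nimSum (heads m s V) ^^^ (coin s p ^^^ secondCoin s q p) := by
  rw [← nimSum_erase_zero, heads_mirrorExchange hs hs' hV h hq hp, nimSum_erase_zero,
    nimSum_symmDiff, nimSum_pair (coin_ne_secondCoin hs' h)]

theorem exists_isInversion_of_mem_heads (hs : 1 ≤ s) (hV : IsAntisymmetric s V) {x y : ℕ}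
    (hx : x ∈ heads m s V) (hyx : y < x) :
    ∃ q p, IsInversion V q p ∧ coin s p = x ∧ secondCoin s q p = y := by
  obtain ⟨⟨hx1, -⟩, hxV⟩ := mem_heads.1 hx
  suffices ∃ q, q ∉ V ∧ q < x + s - 1 ∧ secondCoin s q (x + s - 1) = y by
    obtain ⟨q, hq, hlt, hy⟩ := this
    exact ⟨q, _, ⟨hq, hxV, hlt⟩, coin_add_sub_one (by omega) hx1, hy⟩
  have notMem_mirror {z : ℕ} (hz : (z : ℤ) + s - 1 ∈ V) : 1 - (z : ℤ) ∉ V :=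
    ((hV _).1 (by convert hz using 1; ring)).1
  unfold secondCoin
  rcases Nat.eq_zero_or_pos y with rfl | hy
  · exact ⟨1 - x, notMem_mirror hxV, by omega, if_pos (by ring)⟩
  by_cases hyV : (y : ℤ) + s - 1 ∈ V
  · refine ⟨1 - y, notMem_mirror hyV, by omega, ?_⟩
    rw [if_neg (by omega), coin]
    omega
  · refine ⟨y + s - 1, hyV, by omega, ?_⟩
    rw [if_neg (by omega), coin_add_sub_one (by omega) hy]

end Coins

section Rectangle

variable {m n : ℕ}

theorem mem_verticalSteps_rect {k : ℤ} :
    k ∈ verticalSteps (rect m n) ↔ (n - m < k ∧ k ≤ n) ∨ k ≤ -m := by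
  have hrow (i : ℕ) : (rect m n).rowLen i = if i < m then n else 0 := by
    refine eq_of_forall_lt_iff fun j => ?_
    rw [← mem_iff_lt_rowLen, mem_rect]
    split_ifs <;> omega
  simp only [verticalSteps, Set.mem_range, hrow]
  constructor
  · rintro ⟨i, rfl⟩
    split_ifs <;> omega
  · rintro (h | h)
    · exact ⟨(n - k).toNat, by rw [if_pos (by omega)]; omega⟩
    · exact ⟨(-k).toNat, by rw [if_neg (by omega)]; omega⟩

theorem isAntisymmetric_verticalSteps_rect (hmn : m ≤ n) (hnm : n ≤ m + 1) :
    IsAntisymmetric (n - m + 1) (verticalSteps (rect m n)) := by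
  intro k
  rw [mem_verticalSteps_rect, mem_verticalSteps_rect]
  omega

theorem heads_verticalSteps_rect (m n : ℕ) :
    heads m (n - m + 1) (verticalSteps (rect m n)) = Finset.Icc 1 m := by
  ext x
  rw [mem_heads, mem_verticalSteps_rect, Finset.mem_Icc]
  omega

theorem pos_le_rect (P : (rectMHRG m n).Pos) : P.1 ≤ rect m n := by
  obtain ⟨Z, hZ⟩ := P
  induction hZ with
  | refl => exact le_rfl
  | tail _ hmove ih => exact hmove.lt.le.trans ih

theorem grundy_eq_nimSum_heads (hmn : m ≤ n) (hnm : n ≤ m + 1) {P : (rectMHRG m n).Pos}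
    (hP : IsAntisymmetric (n - m + 1) (verticalSteps P.1)) :
    (rectMHRG m n).grundy P = nimSum (heads m (n - m + 1) (verticalSteps P.1)) := by
  have turn {P : (rectMHRG m n).Pos} (hP : IsAntisymmetric (n - m + 1) (verticalSteps P.1))
      {q p : ℤ} (h : IsInversion (verticalSteps P.1) q p) :=
    nimSum_heads_mirrorExchange (m := m) (by omega) (by omega) hP h
      (le_of_notMem_verticalSteps (pos_le_rect P) h.notMem)
      (by have := le_of_mem_verticalSteps (pos_le_rect P) h.mem; omega)
  refine (rectMHRG m n).grundy_eq_of_forall_move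
    {P | IsAntisymmetric (n - m + 1) (verticalSteps P.1)}
    (fun P => nimSum (heads m (n - m + 1) (verticalSteps P.1))) ?_ ?_ ?_ hP
  · intro P hP Q hPQ
    obtain ⟨q, p, h, hQ⟩ := exists_isInversion_of_move (pos_le_rect P) hP hPQ
    rw [Set.mem_ofPred_eq, hQ]
    exact hP.mirrorExchange h
  · intro P hP Q hPQ heq
    obtain ⟨q, p, h, hQ⟩ := exists_isInversion_of_move (pos_le_rect P) hP hPQ
    rw [hQ, turn hP h] at heq
    exact coin_ne_secondCoin (by omega) h
      (Nat.xor_eq_zero_iff.1 (Nat.xor_right_injective (heq.trans (Nat.xor_zero _).symm)))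
  · intro P hP v hv
    obtain ⟨x, hx, y, hyx, hxor⟩ := exists_nimSum_xor_eq_of_lt hv
    obtain ⟨q, p, h, rfl, rfl⟩ := exists_isInversion_of_mem_heads (by omega) hP hx hyx
    obtain ⟨Z, hPZ, hZ⟩ := exists_move_of_isInversion (pos_le_rect P) hP h
    refine ⟨⟨Z, P.2.tail hPZ⟩, hPZ, ?_⟩
    dsimp only
    rw [hZ, turn hP h, hxor]

theorem grundy_start_rectMHRG (hmn : m ≤ n) (hnm : n ≤ m + 1) :
    (rectMHRG m n).grundy (rectMHRG m n).start = nimSumUpTo m := by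
  have hstart : (rectMHRG m n).start.1 = rect m n := rfl
  rw [grundy_eq_nimSum_heads hmn hnm, hstart, heads_verticalSteps_rect]
  · rfl
  · exact isAntisymmetric_verticalSteps_rect hmn hnm

end Rectangle

end MHRG

theorem corollary5p16 (n : ℕ) (hn : 1 ≤ n) :
    (rectMHRG n n).grundy (rectMHRG n n).start = nimSumUpTo n ∧
      (rectMHRG n (n + 1)).grundy (rectMHRG n (n + 1)).start = nimSumUpTo n :=
  ⟨MHRG.grundy_start_rectMHRG le_rfl n.le_succ, MHRG.grundy_start_rectMHRG n.le_succ le_rfl⟩
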